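/- Let $q\in\mathbb C$ with $0<|q|<1$, and write $(x)_n=\prod_{i=0}^{n-1}(1-xq^i)$, $(x)_\infty=\prod_{i\ge 0}(1-xq^i)$, $(x_1,\dots,x_r)_n=(x_1)_n\cdots(x_r)_n$ (also for $n=\infty$), and $${}_8W_7(a;a_4,\dots,a_8;z)=\sum_{n=0}^\infty\frac{1-aq^{2n}}{1-a}\,\frac{(a,a_4,\dots,a_8)_n}{(q,qa/a_4,\dots,qa/a_8)_n}\,z^n .$$ Let $a,b,c,d,e,f\in\mathbb C\setminus\{0\}$ satisfy $\left|\frac{q^2a^2}{bcdef}\right|<1$, and suppose that no denominator occurring below vanishes, that is, $a\ne 1$ and none of the numbers $$\tfrac ab,\ \tfrac ac,\ \tfrac bc,\ \tfrac cb,\ \tfrac{bc}a,\ \tfrac{b^2}a,\ \tfrac{c^2}a,\ \tfrac{qb}a,\ \tfrac{qc}a,\ \tfrac q\eta,\ \tfrac{qa}\eta,\ \tfrac{qb}\eta,\ \tfrac{qc}\eta\qquad(\eta\in\{d,e,f\})$$ belongs to $\{q^{-n}:n\in\mathbb Z_{\ge 0}\}$. Then the three ${}_8W_7$ series below converge absolutely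 and $${}_8W_7\Big(a;b,c,d,e,f;\tfrac{q^2a^2}{bcdef}\Big)=K(b,c)\;{}_8W_7\Big(\tfrac{b^2}a;b,\tfrac{be}a,\tfrac{bc}a,\tfrac{bd}a,\tfrac{bf}a;\tfrac{q^2a^2}{bcdef}\Big)+K(c,b)\;{}_8W_7\Big(\tfrac{c^2}a;c,\tfrac{ce}a,\tfrac{cb}a,\tfrac{cd}a,\tfrac{cf}a;\tfrac{q^2a^2}{bcdef}\Big),$$ where $$K(b,c)=-\frac ab\,\frac{(qa,\;c,\;b/a,\;c/a)_\infty}{(a/b,\;c/b,\;bc/a,\;qb^2/a)_\infty}\prod_{\eta\in\{d,e,f\}}\frac{(qa/(b\eta),\;qb/\eta)_\infty}{(q/\eta,\;qa/\eta)_\infty},$$ and $K(c,b)$ is obtained from $K(b,c)$ by interchanging $b$ and $c$. -/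

import Mathlib

/-- The finite `q`-shifted factorial `(x; q)_n = ∏_{i < n} (1 - x q^i)`. -/
noncomputable def qPoch (q x : ℂ) (n : ℕ) : ℂ :=
  ∏ i ∈ Finset.range n, (1 - x * q ^ i)

/-- The infinite `q`-shifted factorial `(x; q)_∞ = ∏_{i ≥ 0} (1 - x q^i)`. -/
noncomputable def qPochInf (q x : ℂ) : ℂ :=
  ∏' i : ℕ, (1 - x * q ^ i)

/-- For `|q| < 1` the infinite product defining `(x; q)_∞` converges. -/
theorem multipliable_qPochInf {q : ℂ} (hq : ‖q‖ < 1) (x : ℂ) :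
    Multipliable fun i : ℕ => 1 - x * q ^ i := by
  have h : Summable fun i : ℕ => ‖-(x * q ^ i)‖ := by
    simp only [norm_neg, norm_mul, norm_pow]
    exact (summable_geometric_of_lt_one (norm_nonneg q) hq).mul_left _
  simpa [sub_eq_add_neg] using multipliable_one_add_of_summable h

/-- The `n`-th term of the very-well-poised series `_{r+1}W_r(a; p; z)` with base `q`, where `p`
is the list of the parameters `a₄, …, a_{r+1}`. -/
noncomputable def vwpTerm (q a : ℂ) (p : List ℂ) (z : ℂ) (n : ℕ) : ℂ :=
  (1 - a * q ^ (2 * n)) / (1 - a) *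
    ((qPoch q a n * (p.map fun x => qPoch q x n).prod) /
      (qPoch q q n * (p.map fun x => qPoch q (q * a / x) n).prod)) * z ^ n

/-- The very-well-poised basic hypergeometric series `_{r+1}W_r(a; p; z)` with base `q`;
it is `₈W₇` when `p` has five entries. -/
noncomputable def vwpSeries (q a : ℂ) (p : List ℂ) (z : ℂ) : ℂ :=
  ∑' n : ℕ, vwpTerm q a p z n

/-- The coefficient
`-(a/b) (qa, c, b/a, c/a)_∞ / (a/b, c/b, bc/a, qb²/a)_∞
  · ∏_{η ∈ {d, e, f}} (qa/(bη), qb/η)_∞ / (q/η, qa/η)_∞`. -/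
noncomputable def threeTermCoeff (q a b c d e f : ℂ) : ℂ :=
  -(a / b) *
    (qPochInf q (q * a) * qPochInf q c * qPochInf q (b / a) * qPochInf q (c / a) /
      (qPochInf q (a / b) * qPochInf q (c / b) * qPochInf q (b * c / a) *
        qPochInf q (q * b ^ 2 / a))) *
    (([d, e, f] : List ℂ).map fun η =>
      qPochInf q (q * a / (b * η)) * qPochInf q (q * b / η) /
        (qPochInf q (q / η) * qPochInf q (q * a / η))).prod

/-! Write `a = α ^ 2` and `b, c, d, e, f = αβ, αγ, αδ, αε, αφ`. The argument becomes `q ^ 2 /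
(αβγδεφ)`, the three series are the same expression based at `α`, `β`, `γ`, and the relation says
that a combination of them, permuted cyclically, is zero.

That combination is a limit of a residue identity. In the variable `u + u⁻¹`, take the rational
function with simple poles at `u = α q ^ k, β q ^ k, γ q ^ k` for `k ≤ N`, and numerator `∏ (qu/η,
q/(ηu))_N` over `η = δ, ε, φ`. It has `3N + 3` poles and a numerator of degree at most `3N`, so its
residues sum to zero (`sum_vwpResidue_eq_zero`). By `vwpResidue_eq`, the residue at `α q ^ k` is the
`k`-th series term times a factor whose limit as `N → ∞` does not depend on `k`. Since the argument
has norm less than one, dominated convergence (`BoundedTendsto.tendsto_sum`) gives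
`sum_tsum_vwpSymTerm_eq_zero`; `threeTermCoeff_mul` recognises `K` as minus a quotient of limiting
factors.

Distinct poles require that none of `α ^ 2, αβ, αγ`, that is `a, b, c`, is a power `q ^ (-n)`, which
is not assumed. After multiplication by `(α ^ 2, αβ, αγ)_{2N+1}` the finite identity is continuous
in `α`, so it extends from a dense set of `α` (`vwpFiniteSum_eq_zero`). -/

open Filter Topology

/-! ### Finite and infinite `q`-shifted factorials. -/

section Pochhammer

variable {q : ℂ}

theorem qPoch_succ (q x : ℂ) (n : ℕ) : qPoch q x (n + 1) = qPoch q x n * (1 - x * q ^ n) :=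
  Finset.prod_range_succ _ _

theorem qPoch_add (q x : ℂ) (m n : ℕ) :
    qPoch q x (m + n) = qPoch q x m * qPoch q (x * q ^ m) n := by
  simp only [qPoch, Finset.prod_range_add, pow_add, mul_assoc]

theorem qPoch_ne_zero {x : ℂ} (h : ∀ n : ℕ, x * q ^ n ≠ 1) (n : ℕ) : qPoch q x n ≠ 0 :=
  Finset.prod_ne_zero_iff.2 fun i _ => sub_ne_zero.2 (h i).symm

theorem mul_pow_ne_one_shift {x : ℂ} (h : ∀ n : ℕ, x * q ^ n ≠ 1) (n : ℕ) :
    q * x * q ^ n ≠ 1 := by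
  have := h (n + 1)
  rwa [pow_succ', ← mul_assoc, mul_comm x] at this

theorem self_mul_pow_ne_one (hq : ‖q‖ < 1) (n : ℕ) : q * q ^ n ≠ 1 := by
  intro h
  have h1 : ‖q ^ (n + 1)‖ < 1 := by
    rw [norm_pow]; exact pow_lt_one₀ (norm_nonneg _) hq (by omega)
  rw [pow_succ', h] at h1
  simp at h1

theorem summable_norm_mul_pow (hq : ‖q‖ < 1) (x : ℂ) : Summable fun i : ℕ => ‖-(x * q ^ i)‖ := by
  simp only [norm_neg, norm_mul, norm_pow]
  exact (summable_geometric_of_lt_one (norm_nonneg q) hq).mul_left _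

theorem qPochInf_ne_zero (hq : ‖q‖ < 1) {x : ℂ} (h : ∀ n : ℕ, x * q ^ n ≠ 1) :
    qPochInf q x ≠ 0 := by
  have := tprod_one_add_ne_zero_of_summable (f := fun i : ℕ => -(x * q ^ i))
    (fun i => by rw [← sub_eq_add_neg]; exact sub_ne_zero.2 (h i).symm)
    (summable_norm_mul_pow hq x)
  simpa only [qPochInf, sub_eq_add_neg] using this

theorem tendsto_qPoch (hq : ‖q‖ < 1) (x : ℂ) :
    Tendsto (qPoch q x) atTop (𝓝 (qPochInf q x)) :=
  (multipliable_qPochInf hq x).hasProd.tendsto_prod_nat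

theorem qPochInf_eq_mul (hq : ‖q‖ < 1) (x : ℂ) :
    qPochInf q x = (1 - x) * qPochInf q (q * x) := by
  refine tendsto_nhds_unique ((tendsto_add_atTop_iff_nat 1).2 (tendsto_qPoch hq x)) ?_
  refine ((tendsto_qPoch hq (q * x)).const_mul (1 - x)).congr fun n => ?_
  rw [add_comm n 1, qPoch_add]
  simp [qPoch, mul_comm]

/-- The bound is uniform in `n` and vanishes as `x → 0`; this controls products whose base point and
length both vary with `N`. -/
theorem norm_qPoch_sub_one_le (hq : ‖q‖ < 1) (x : ℂ) (n : ℕ) :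
    ‖qPoch q x n - 1‖ ≤ Real.exp (‖x‖ * (1 - ‖q‖)⁻¹) - 1 := by
  have h := Finset.norm_prod_one_add_sub_one_le (Finset.range n) fun i => -(x * q ^ i)
  simp only [← sub_eq_add_neg] at h
  refine h.trans (sub_le_sub_right (Real.exp_le_exp.2 ?_) 1)
  simp only [norm_neg, norm_mul, norm_pow, ← Finset.mul_sum]
  refine mul_le_mul_of_nonneg_left ?_ (norm_nonneg x)
  rw [← tsum_geometric_of_lt_one (norm_nonneg q) hq]
  exact (summable_geometric_of_lt_one (norm_nonneg q) hq).sum_le_tsum _ fun i _ => by positivity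

/-- Reversal of the order of the factors in a finite `q`-shifted factorial. -/
theorem qPoch_div_pow (hq0 : q ≠ 0) {x : ℂ} (hx : x ≠ 0) (k : ℕ) :
    qPoch q (x / q ^ k) k = qPoch q (q / x) k * (-x) ^ k / ∏ i ∈ Finset.range k, q ^ (i + 1) := by
  induction k with
  | zero => simp [qPoch]
  | succ k ih =>
    have h : qPoch q (x / q ^ (k + 1)) (k + 1)
        = (1 - x / q ^ (k + 1)) * qPoch q (x / q ^ k) k := by
      rw [add_comm k 1, qPoch_add]
      congr 1
      · simp [qPoch]
      · congr 1
        field_simp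
        ring
    have hp : ∏ i ∈ Finset.range k, q ^ (i + 1) ≠ 0 :=
      Finset.prod_ne_zero_iff.2 fun i _ => pow_ne_zero _ hq0
    rw [h, ih, qPoch_succ, Finset.prod_range_succ]
    field_simp
    ring

theorem qPoch_div_pow_add (hq0 : q ≠ 0) {x : ℂ} (hx : x ≠ 0) (k n : ℕ) :
    qPoch q (x / q ^ k) (k + n) = qPoch q (q / x) k * (-x) ^ k /
      (∏ i ∈ Finset.range k, q ^ (i + 1)) * qPoch q x n := by
  rw [qPoch_add, qPoch_div_pow hq0 hx, div_mul_cancel₀ _ (pow_ne_zero k hq0)]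

end Pochhammer

/-! ### Dominated convergence for sums whose terms and length depend on `N`. -/

section Tannery

/-- A double sequence that is bounded on `k ≤ N` and converges for each `k`, as `N → ∞`, to a limit
not depending on `k`. -/
def BoundedTendsto (g : ℕ → ℕ → ℂ) (L : ℂ) : Prop :=
  (∃ C : ℝ, ∀ N k, k ≤ N → ‖g N k‖ ≤ C) ∧ ∀ k, Tendsto (fun N => g N k) atTop (𝓝 L)

theorem BoundedTendsto.mul {g h : ℕ → ℕ → ℂ} {L M : ℂ} (hg : BoundedTendsto g L)
    (hh : BoundedTendsto h M) : BoundedTendsto (fun N k => g N k * h N k) (L * M) := by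
  obtain ⟨⟨C, hC⟩, hgL⟩ := hg
  obtain ⟨⟨D, hD⟩, hhM⟩ := hh
  refine ⟨⟨C * D, fun N k hk => ?_⟩, fun k => (hgL k).mul (hhM k)⟩
  rw [norm_mul]
  exact mul_le_mul (hC N k hk) (hD N k hk) (norm_nonneg _) ((norm_nonneg _).trans (hC N k hk))

theorem BoundedTendsto.const (L : ℂ) : BoundedTendsto (fun _ _ => L) L :=
  ⟨⟨‖L‖, fun _ _ _ => le_rfl⟩, fun _ => tendsto_const_nhds⟩

theorem BoundedTendsto.of_tendsto {u : ℕ → ℂ} {L : ℂ} (hu : Tendsto u atTop (𝓝 L))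
    {m : ℕ → ℕ → ℕ} (hm : ∀ k, Tendsto (fun N => m N k) atTop atTop) :
    BoundedTendsto (fun N k => u (m N k)) L := by
  obtain ⟨C, hC⟩ := (Metric.isBounded_range_of_tendsto u hu).exists_norm_le
  exact ⟨⟨C, fun N k _ => hC _ ⟨_, rfl⟩⟩, fun k => hu.comp (hm k)⟩

/-- Tannery's theorem: extended by zero beyond `k = N`, the summands are dominated by a constant
multiple of `‖v k‖`. -/
theorem BoundedTendsto.tendsto_sum {g : ℕ → ℕ → ℂ} {L : ℂ} (hg : BoundedTendsto g L)
    {v : ℕ → ℂ} (hv : Summable v) :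
    Tendsto (fun N => ∑ k ∈ Finset.range (N + 1), v k * g N k) atTop (𝓝 ((∑' k, v k) * L)) := by
  obtain ⟨⟨C, hC⟩, hgL⟩ := hg
  have key : Tendsto (fun N => ∑' k, if k ≤ N then v k * g N k else 0) atTop
      (𝓝 (∑' k, v k * L)) := by
    refine tendsto_tsum_of_dominated_convergence (bound := fun k => ‖v k‖ * C)
      (hv.norm.mul_right C) (fun k => ?_) (Eventually.of_forall fun N k => ?_)
    · refine ((hgL k).const_mul (v k)).congr' ?_
      filter_upwards [eventually_ge_atTop k] with N hN
      rw [if_pos hN]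
    · split_ifs with h
      · rw [norm_mul]
        exact mul_le_mul_of_nonneg_left (hC N k h) (norm_nonneg _)
      · rw [norm_zero]
        exact mul_nonneg (norm_nonneg _) ((norm_nonneg _).trans (hC 0 0 le_rfl))
  rw [tsum_mul_right] at key
  refine key.congr fun N => ?_
  rw [tsum_eq_sum (s := Finset.range (N + 1))]
  · exact Finset.sum_congr rfl fun k hk => if_pos (Nat.lt_succ_iff.1 (Finset.mem_range.1 hk))
  · intro k hk
    rw [if_neg]
    simpa [Nat.lt_succ_iff] using hk

variable {q : ℂ}

theorem boundedTendsto_qPoch (hq : ‖q‖ < 1) (x : ℂ) {m : ℕ → ℕ → ℕ}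
    (hm : ∀ k, Tendsto (fun N => m N k) atTop atTop) :
    BoundedTendsto (fun N k => qPoch q x (m N k)) (qPochInf q x) :=
  .of_tendsto (tendsto_qPoch hq x) hm

theorem boundedTendsto_qPoch_inv (hq : ‖q‖ < 1) {x : ℂ} (hx : ∀ n : ℕ, x * q ^ n ≠ 1)
    {m : ℕ → ℕ → ℕ} (hm : ∀ k, Tendsto (fun N => m N k) atTop atTop) :
    BoundedTendsto (fun N k => (qPoch q x (m N k))⁻¹) (qPochInf q x)⁻¹ :=
  .of_tendsto (u := fun n => (qPoch q x n)⁻¹)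
    ((tendsto_qPoch hq x).inv₀ (qPochInf_ne_zero hq hx)) hm

/-- The base point `x q ^ (N + 1 + k)` tends to zero, so the product tends to 1 however many factors
it has. -/
theorem boundedTendsto_qPoch_tail (hq : ‖q‖ < 1) (x : ℂ) :
    BoundedTendsto (fun N k => qPoch q (x * q ^ (N + 1 + k)) (N - k)) 1 := by
  have hle : ∀ y : ℂ, ∀ n, ‖qPoch q y n‖ ≤ Real.exp (‖y‖ * (1 - ‖q‖)⁻¹) := fun y n => by
    have h1 := norm_qPoch_sub_one_le hq y n
    have h2 := norm_add_le (qPoch q y n - 1) 1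
    rw [sub_add_cancel, norm_one] at h2
    linarith
  have hpos : 0 ≤ (1 - ‖q‖)⁻¹ := inv_nonneg.2 (sub_nonneg.2 hq.le)
  refine ⟨⟨Real.exp (‖x‖ * (1 - ‖q‖)⁻¹), fun N k _ => (hle _ _).trans ?_⟩, fun k => ?_⟩
  · refine Real.exp_le_exp.2 (mul_le_mul_of_nonneg_right ?_ hpos)
    rw [norm_mul, norm_pow]
    exact mul_le_of_le_one_right (norm_nonneg _) (pow_le_one₀ (norm_nonneg _) hq.le)
  · rw [tendsto_iff_norm_sub_tendsto_zero]
    refine squeeze_zero (fun _ => norm_nonneg _) (fun N => norm_qPoch_sub_one_le hq _ _) ?_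
    have h0 : Tendsto (fun N : ℕ => x * q ^ (N + 1 + k)) atTop (𝓝 (x * 0)) :=
      ((tendsto_pow_atTop_nhds_zero_of_norm_lt_one hq).comp
        (tendsto_atTop_mono (fun N => by simp only [id]; omega) tendsto_id)).const_mul x
    have h1 : Tendsto (fun N : ℕ => Real.exp (‖x * q ^ (N + 1 + k)‖ * (1 - ‖q‖)⁻¹) - 1) atTop
        (𝓝 (Real.exp (‖x * 0‖ * (1 - ‖q‖)⁻¹) - 1)) :=
      ((Real.continuous_exp.tendsto _).comp (h0.norm.mul_const _)).sub_const 1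
    simpa using h1

end Tannery

/-! ### The finite residue identity. -/

section FiniteIdentity

/-- Lagrange interpolation: the sum of the residues of `P / ∏ i, c i * (v i - X)` vanishes when the
degree of `P` is small. -/
theorem sum_eval_div_prod_erase_eq_zero {ι : Type*} [DecidableEq ι] {s : Finset ι} {c v : ι → ℂ}
    (hv : Set.InjOn v s) {P : Polynomial ℂ}
    (hP : P.natDegree + 1 < s.card) :
    ∑ i ∈ s, P.eval (v i) / (c i * ∏ j ∈ s.erase i, c j * (v j - v i)) = 0 := by
  have hdeg : P.degree < s.card :=
    Polynomial.degree_le_natDegree.trans_lt (by exact_mod_cast (by omega))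
  -- The interpolation formula for the coefficient of `X ^ (s.card - 1)`, which is zero by the
  -- degree bound.
  have h := Lagrange.coeff_eq_sum hv hdeg
  rw [Polynomial.coeff_eq_zero_of_natDegree_lt (by omega)] at h
  have key : ∀ i ∈ s, P.eval (v i) / (c i * ∏ j ∈ s.erase i, c j * (v j - v i)) =
      ((-1) ^ (s.card - 1) * ∏ j ∈ s, c j)⁻¹ *
        (P.eval (v i) / ∏ j ∈ s.erase i, (v i - v j)) := by
    intro i hi
    have h1 : ∏ j ∈ s.erase i, c j * (v j - v i) =
        (-1) ^ (s.card - 1) * (∏ j ∈ s.erase i, c j) * ∏ j ∈ s.erase i, (v i - v j) := by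
      rw [← Finset.card_erase_of_mem hi, ← Finset.prod_const, ← Finset.prod_mul_distrib,
        ← Finset.prod_mul_distrib]
      exact Finset.prod_congr rfl fun j _ => by ring
    rw [h1, ← Finset.mul_prod_erase s c hi, div_eq_mul_inv, div_eq_mul_inv]
    simp only [mul_inv]
    ring
  rw [Finset.sum_congr rfl key, ← Finset.mul_sum, ← h, mul_zero]

theorem add_inv_ne_add_inv {x y : ℂ} (hx : x ≠ 0) (hy : y ≠ 0) (hxy : x ≠ y) (h1 : x * y ≠ 1) :
    x + x⁻¹ ≠ y + y⁻¹ := by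
  intro h
  have : (x - y) * (x * y - 1) = 0 := by
    field_simp at h
    linear_combination h
  rcases mul_eq_zero.1 this with h | h
  · exact hxy (sub_eq_zero.1 h)
  · exact h1 (sub_eq_zero.1 h)

/-- Factors a difference of nodes, so that a product over `y = β q ^ l` becomes a pair of
`q`-shifted factorials. -/
theorem mul_add_inv_sub_add_inv {x y : ℂ} (hx : x ≠ 0) (hy : y ≠ 0) :
    y * (y + y⁻¹ - (x + x⁻¹)) = (1 - y * x) * (1 - y / x) := by
  field_simp
  ring

/-- The polynomial in `u + u⁻¹` equal to `∏ i < N, (1 - t q ^ i u) (1 - t q ^ i / u)`. -/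
noncomputable def symPoch (q t : ℂ) (N : ℕ) : Polynomial ℂ :=
  ∏ i ∈ Finset.range N, (Polynomial.C (1 + (t * q ^ i) ^ 2) - Polynomial.C (t * q ^ i) * .X)

theorem natDegree_symPoch_le (q t : ℂ) (N : ℕ) : (symPoch q t N).natDegree ≤ N := by
  refine (Polynomial.natDegree_prod_le _ _).trans ?_
  refine (Finset.sum_le_card_nsmul _ _ 1 fun i _ => ?_).trans (by simp)
  compute_degree

theorem eval_symPoch (q t : ℂ) {u : ℂ} (hu : u ≠ 0) (N : ℕ) :
    (symPoch q t N).eval (u + u⁻¹) = qPoch q (t * u) N * qPoch q (t / u) N := by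
  simp only [symPoch, qPoch, Polynomial.eval_prod, ← Finset.prod_mul_distrib]
  refine Finset.prod_congr rfl fun i _ => ?_
  simp only [Polynomial.eval_sub, Polynomial.eval_mul, Polynomial.eval_C, Polynomial.eval_X]
  field_simp
  ring

/-- The residue, at `u = α q ^ k`, of the rational function of `u + 1 / u` in the finite three-term
identity. -/
noncomputable def vwpResidue (q α β γ δ ε φ : ℂ) (N k : ℕ) : ℂ :=
  (qPoch q (q / δ * (α * q ^ k)) N * qPoch q (q / δ / (α * q ^ k)) N *
    (qPoch q (q / ε * (α * q ^ k)) N * qPoch q (q / ε / (α * q ^ k)) N) *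
    (qPoch q (q / φ * (α * q ^ k)) N * qPoch q (q / φ / (α * q ^ k)) N)) /
  (α * q ^ k *
    ((∏ l ∈ (Finset.range (N + 1)).erase k,
      (1 - α * q ^ l * (α * q ^ k)) * (1 - α * q ^ l / (α * q ^ k))) *
    (qPoch q (β * (α * q ^ k)) (N + 1) * qPoch q (β / (α * q ^ k)) (N + 1)) *
    (qPoch q (γ * (α * q ^ k)) (N + 1) * qPoch q (γ / (α * q ^ k)) (N + 1))))

/-- Addition in `Fin 3` is cyclic, so the two families other than that of `i` are `i.1 + 1` and `i.1
+ 2`, whichever `i.1` is. -/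
theorem prod_erase_product {f : Fin 3 × ℕ → ℂ} (s : Finset ℕ) (i : Fin 3 × ℕ) :
    ∏ j ∈ (Finset.univ ×ˢ s).erase i, f j =
      (∏ l ∈ s.erase i.2, f (i.1, l)) * (∏ l ∈ s, f (i.1 + 1, l)) *
        ∏ l ∈ s, f (i.1 + 2, l) := by
  have h : (Finset.univ ×ˢ s).erase i =
      ({i.1} : Finset (Fin 3)) ×ˢ s.erase i.2 ∪
        (({i.1 + 1} : Finset (Fin 3)) ×ˢ s ∪ ({i.1 + 2} : Finset (Fin 3)) ×ˢ s) := by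
    obtain ⟨a, k⟩ := i
    ext ⟨b, l⟩
    fin_cases a <;> fin_cases b <;> simp
  rw [h, Finset.prod_union, Finset.prod_union, Finset.prod_product, Finset.prod_product,
    Finset.prod_product, Finset.prod_singleton, Finset.prod_singleton, Finset.prod_singleton,
    mul_assoc]
  · rw [Finset.disjoint_product]
    left
    obtain ⟨a, k⟩ := i
    fin_cases a <;> simp
  · rw [Finset.disjoint_union_right, Finset.disjoint_product, Finset.disjoint_product]
    obtain ⟨a, k⟩ := i
    fin_cases a <;> simp

/-- Two nodes `u + u⁻¹` and `v + v⁻¹` agree only if `u = v` or `u v = 1`. The hypotheses `hdiv` and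
`hpp` exclude these, together with `q ^ n ≠ 1` for `n > 0` within one family. -/
theorem sum_vwpResidue_eq_zero {q : ℂ} (hq0 : q ≠ 0) (hq1 : ‖q‖ < 1) {p : Fin 3 → ℂ}
    (hp : ∀ i, p i ≠ 0) (hpp : ∀ i j, ∀ n : ℕ, p i * p j * q ^ n ≠ 1)
    (hdiv : ∀ i j, i ≠ j → ∀ n : ℕ, p i * q ^ n ≠ p j) (δ ε φ : ℂ) (N : ℕ) :
    (∑ k ∈ Finset.range (N + 1), vwpResidue q (p 0) (p 1) (p 2) δ ε φ N k) +
      (∑ k ∈ Finset.range (N + 1), vwpResidue q (p 1) (p 2) (p 0) δ ε φ N k) +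
      (∑ k ∈ Finset.range (N + 1), vwpResidue q (p 2) (p 0) (p 1) δ ε φ N k) = 0 := by
  set y : Fin 3 × ℕ → ℂ := fun i => p i.1 * q ^ i.2 with hy
  have hy0 : ∀ i, y i ≠ 0 := fun i => mul_ne_zero (hp _) (pow_ne_zero _ hq0)
  have hne : ∀ i j : Fin 3, ∀ k n : ℕ, (i, k) ≠ (j, k + n) → y (i, k) ≠ y (j, k + n) := by
    intro i j k n hij h
    simp only [hy, pow_add] at h
    have h' : p j * q ^ n = p i :=
      mul_right_cancel₀ (pow_ne_zero k hq0) (by linear_combination -h)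
    by_cases hji : j = i
    · subst hji
      have hn : n ≠ 0 := by rintro rfl; simp at hij
      have h1 : q ^ n = 1 := mul_left_cancel₀ (hp j) (by rw [h', mul_one])
      obtain ⟨m, rfl⟩ := Nat.exists_eq_succ_of_ne_zero hn
      exact self_mul_pow_ne_one hq1 m (by rw [← h1, pow_succ'])
    · exact hdiv j i hji n h'
  have hv : Set.InjOn (fun i => y i + (y i)⁻¹)
      ((Finset.univ ×ˢ Finset.range (N + 1) : Finset (Fin 3 × ℕ)) : Set (Fin 3 × ℕ)) := by
    rintro ⟨i, k⟩ - ⟨j, l⟩ - h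
    by_contra hij
    refine add_inv_ne_add_inv (hy0 _) (hy0 _) ?_ ?_ h
    · rcases le_total k l with hkl | hkl
      · obtain ⟨n, rfl⟩ := Nat.exists_eq_add_of_le hkl
        exact hne i j k n hij
      · obtain ⟨n, rfl⟩ := Nat.exists_eq_add_of_le hkl
        exact (hne j i l n (Ne.symm hij)).symm
    · have := hpp i j (k + l)
      simp only [hy]
      rwa [pow_add, show p i * p j * (q ^ k * q ^ l) = p i * q ^ k * (p j * q ^ l) by ring] at this
  -- Degree at most `3N` against `3(N + 1)` nodes: `3N + 1 < 3N + 3`.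
  have key := sum_eval_div_prod_erase_eq_zero (c := y) hv
    (P := symPoch q (q / δ) N * symPoch q (q / ε) N * symPoch q (q / φ) N) (by
      have h1 := natDegree_symPoch_le q (q / δ) N
      have h2 := natDegree_symPoch_le q (q / ε) N
      have h3 := natDegree_symPoch_le q (q / φ) N
      have h4 := Polynomial.natDegree_mul_le (p := symPoch q (q / δ) N * symPoch q (q / ε) N)
        (q := symPoch q (q / φ) N)
      have h5 := Polynomial.natDegree_mul_le (p := symPoch q (q / δ) N)
        (q := symPoch q (q / ε) N)
      rw [Finset.card_product, Finset.card_range, Finset.card_univ, Fintype.card_fin]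
      omega)
  have hterm : ∀ i : Fin 3 × ℕ,
      Polynomial.eval (y i + (y i)⁻¹)
        (symPoch q (q / δ) N * symPoch q (q / ε) N * symPoch q (q / φ) N) /
        (y i * ∏ j ∈ (Finset.univ ×ˢ Finset.range (N + 1)).erase i,
          y j * (y j + (y j)⁻¹ - (y i + (y i)⁻¹))) =
      vwpResidue q (p i.1) (p (i.1 + 1)) (p (i.1 + 2)) δ ε φ N i.2 := by
    rintro ⟨i, k⟩
    have hA : ∀ j : Fin 3, ∏ l ∈ Finset.range (N + 1),
        (1 - y (j, l) * y (i, k)) * (1 - y (j, l) / y (i, k)) =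
        qPoch q (p j * y (i, k)) (N + 1) * qPoch q (p j / y (i, k)) (N + 1) := by
      intro j
      simp only [qPoch, ← Finset.prod_mul_distrib]
      refine Finset.prod_congr rfl fun l _ => ?_
      simp only [hy]
      ring
    simp only [mul_add_inv_sub_add_inv (hy0 _) (hy0 _), Polynomial.eval_mul,
      eval_symPoch _ _ (hy0 _), prod_erase_product, hA, vwpResidue]
    rfl
  simp only [hterm] at key
  rw [Finset.sum_product, Fin.sum_univ_three] at key
  exact key

end FiniteIdentity

/-! ### Residues as series terms times weights. -/

section Conversion

/-- The term of the very-well-poised series with `a = α ^ 2` and parameters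
`α β, α γ, α δ, α ε, α φ`, multiplied by `1 - a`. -/
noncomputable def vwpSymTerm (q z α β γ δ ε φ : ℂ) (k : ℕ) : ℂ :=
  (1 - α ^ 2 * q ^ (2 * k)) *
    (qPoch q (α ^ 2) k * (qPoch q (α * β) k * qPoch q (α * γ) k * qPoch q (α * δ) k *
      qPoch q (α * ε) k * qPoch q (α * φ) k)) *
    ((qPoch q q k)⁻¹ * ((qPoch q (q * α / β) k)⁻¹ * (qPoch q (q * α / γ) k)⁻¹ *
      (qPoch q (q * α / δ) k)⁻¹ * (qPoch q (q * α / ε) k)⁻¹ * (qPoch q (q * α / φ) k)⁻¹)) * z ^ k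

/-- The factor by which `vwpResidue` differs from `vwpSymTerm`, apart from the denominators
`(α ^ 2, α β, α γ; q)_{N + 1 + k}`. -/
noncomputable def vwpWeight (q α β γ δ ε φ : ℂ) (N k : ℕ) : ℂ :=
  α⁻¹ * (qPoch q (q * α / δ) (N + k) * qPoch q (q / (α * δ)) (N - k)) *
    (qPoch q (q * α / ε) (N + k) * qPoch q (q / (α * ε)) (N - k)) *
    (qPoch q (q * α / φ) (N + k) * qPoch q (q / (α * φ)) (N - k)) *
    ((qPoch q q (N - k))⁻¹ * (qPoch q (β / α) (N + 1 - k))⁻¹ * (qPoch q (γ / α) (N + 1 - k))⁻¹)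

variable {q : ℂ}

theorem qPoch_mul_pow {x : ℂ} {k : ℕ} (h : qPoch q x k ≠ 0) (n : ℕ) :
    qPoch q (x * q ^ k) n = qPoch q x (n + k) * (qPoch q x k)⁻¹ := by
  rw [add_comm n k, qPoch_add]
  field_simp

/-- Multiplying the base point by `q ^ k` drops the first `k` factors of a longer product; dividing
it by `q ^ k` puts `k` new factors in front, which are reversed. This separates the dependence on
`N` from the factors of the series term. -/
theorem qPoch_numerator_pair (hq0 : q ≠ 0) {α η : ℂ} (hα : α ≠ 0) (hη : η ≠ 0) {N k : ℕ}
    (hk : k ≤ N) (h : qPoch q (q * α / η) k ≠ 0) :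
    qPoch q (q / η * (α * q ^ k)) N * qPoch q (q / η / (α * q ^ k)) N =
      qPoch q (q * α / η) (N + k) * qPoch q (q / (α * η)) (N - k) *
        (qPoch q (α * η) k * (qPoch q (q * α / η) k)⁻¹) *
        ((-(q / (α * η))) ^ k / ∏ i ∈ Finset.range k, q ^ (i + 1)) := by
  have h1 : q / η * (α * q ^ k) = q * α / η * q ^ k := by ring
  have h2 : q / η / (α * q ^ k) = q / (α * η) / q ^ k := by field_simp
  have h3 : q / (q / (α * η)) = α * η := by field_simp
  obtain ⟨n, rfl⟩ := Nat.exists_eq_add_of_le hk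
  rw [h1, h2, qPoch_mul_pow h, qPoch_div_pow_add hq0 (by positivity), h3, Nat.add_sub_cancel_left]
  ring

theorem qPoch_denominator_pair (hq0 : q ≠ 0) {α β : ℂ} (hα : α ≠ 0) (hβ : β ≠ 0) {N k : ℕ}
    (hk : k ≤ N) (h : qPoch q (α * β) k ≠ 0) :
    qPoch q (β * (α * q ^ k)) (N + 1) * qPoch q (β / (α * q ^ k)) (N + 1) =
      qPoch q (α * β) (N + 1 + k) * qPoch q (β / α) (N + 1 - k) *
        ((qPoch q (α * β) k)⁻¹ * qPoch q (q * α / β) k) *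
        ((-(β / α)) ^ k / ∏ i ∈ Finset.range k, q ^ (i + 1)) := by
  have h1 : β * (α * q ^ k) = α * β * q ^ k := by ring
  have h2 : β / (α * q ^ k) = β / α / q ^ k := by field_simp
  have h3 : q / (β / α) = q * α / β := by field_simp
  obtain ⟨n, rfl⟩ := Nat.exists_eq_add_of_le hk
  rw [h1, h2, qPoch_mul_pow h, add_assoc k n 1, qPoch_div_pow_add hq0 (by positivity), h3,
    Nat.add_sub_cancel_left]
  ring

/-- The omitted index `l = k` is the source of the very-well-poised factor `1 - α ^ 2 q ^ (2k)`. In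
the quotients, `l < k` gives a reversed product and `l > k` gives `(q)_{N-k}`. -/
theorem prod_erase_self_pair (hq0 : q ≠ 0) {α : ℂ} (hα : α ≠ 0) {N k : ℕ}
    (hk : k ≤ N) (h : ∀ n : ℕ, α ^ 2 * q ^ n ≠ 1) :
    ∏ l ∈ (Finset.range (N + 1)).erase k,
      (1 - α * q ^ l * (α * q ^ k)) * (1 - α * q ^ l / (α * q ^ k)) =
      qPoch q (α ^ 2) (N + 1 + k) * qPoch q q (N - k) *
        ((qPoch q (α ^ 2) k)⁻¹ * (1 - α ^ 2 * q ^ (2 * k))⁻¹ * qPoch q q k) *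
        ((-1) ^ k / ∏ i ∈ Finset.range k, q ^ (i + 1)) := by
  have hmem : k ∈ Finset.range (N + 1) := Finset.mem_range.2 (by omega)
  have hne : 1 - α ^ 2 * q ^ (2 * k) ≠ 0 := sub_ne_zero.2 (h _).symm
  have h1 : ∏ l ∈ (Finset.range (N + 1)).erase k, (1 - α * q ^ l * (α * q ^ k)) =
      qPoch q (α ^ 2) (N + 1 + k) * (qPoch q (α ^ 2) k)⁻¹ * (1 - α ^ 2 * q ^ (2 * k))⁻¹ := by
    rw [← qPoch_mul_pow (qPoch_ne_zero h k), qPoch, ← Finset.mul_prod_erase _ _ hmem,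
      mul_assoc (α ^ 2), ← pow_add, ← two_mul, mul_comm (1 - α ^ 2 * q ^ (2 * k)),
      mul_inv_cancel_right₀ hne]
    exact Finset.prod_congr rfl fun l _ => by ring
  have h2 : ∏ l ∈ (Finset.range (N + 1)).erase k, (1 - α * q ^ l / (α * q ^ k)) =
      qPoch q (1 / q ^ k) k * qPoch q q (N - k) := by
    obtain ⟨n, rfl⟩ := Nat.exists_eq_add_of_le hk
    have : (Finset.range (k + n + 1)).erase k =
        Finset.range k ∪ (Finset.range n).image fun l => k + 1 + l := by
      ext l
      simp only [Finset.mem_erase, Finset.mem_range, Finset.mem_union, Finset.mem_image]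
      constructor
      · rintro ⟨h1, h2⟩
        rcases lt_or_gt_of_ne h1 with h3 | h3
        · exact .inl h3
        · exact .inr ⟨l - (k + 1), by omega, by omega⟩
      · rintro (h1 | ⟨m, h1, rfl⟩) <;> omega
    rw [this, Finset.prod_union, Finset.prod_image, Nat.add_sub_cancel_left]
    · simp only [qPoch]
      congr 1 <;> refine Finset.prod_congr rfl fun l _ => ?_
      · field_simp
      · field_simp
        ring
    · intro a _ b _ hab
      simpa using hab
    · rw [Finset.disjoint_left]
      intro l hl hl'
      simp only [Finset.mem_range, Finset.mem_image] at hl hl'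
      omega
  rw [Finset.prod_mul_distrib, h1, h2, qPoch_div_pow hq0 one_ne_zero, div_one]
  ring

theorem vwpResidue_eq (hq0 : q ≠ 0) {α β γ δ ε φ : ℂ} (hα : α ≠ 0) (hβ : β ≠ 0)
    (hγ : γ ≠ 0) (hδ : δ ≠ 0) (hε : ε ≠ 0) (hφ : φ ≠ 0) (hαα : ∀ n : ℕ, α ^ 2 * q ^ n ≠ 1)
    (hαβ : ∀ n : ℕ, α * β * q ^ n ≠ 1) (hαγ : ∀ n : ℕ, α * γ * q ^ n ≠ 1)
    (hαδ : ∀ n : ℕ, q * α / δ * q ^ n ≠ 1) (hαε : ∀ n : ℕ, q * α / ε * q ^ n ≠ 1)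
    (hαφ : ∀ n : ℕ, q * α / φ * q ^ n ≠ 1) {N k : ℕ} (hk : k ≤ N) :
    vwpResidue q α β γ δ ε φ N k =
      vwpSymTerm q (q ^ 2 / (α * β * γ * δ * ε * φ)) α β γ δ ε φ k *
        (vwpWeight q α β γ δ ε φ N k *
        ((qPoch q (α ^ 2) (N + 1 + k))⁻¹ * (qPoch q (α * β) (N + 1 + k))⁻¹ *
          (qPoch q (α * γ) (N + 1 + k))⁻¹)) := by
  have hT : ∏ i ∈ Finset.range k, q ^ (i + 1) ≠ 0 :=
    Finset.prod_ne_zero_iff.2 fun i _ => pow_ne_zero _ hq0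
  -- The `k`-th powers left by the reversals, with `q ^ k` from the prefactor `α q ^ k`, combine to
  -- the argument of the series.
  have hz : (-(q / (α * δ))) ^ k * (-(q / (α * ε))) ^ k * (-(q / (α * φ))) ^ k *
      (((-1) ^ k)⁻¹ * ((-(β / α)) ^ k)⁻¹ * ((-(γ / α)) ^ k)⁻¹ * (q ^ k)⁻¹) =
      (q ^ 2 / (α * β * γ * δ * ε * φ)) ^ k := by
    simp only [← inv_pow, ← mul_pow]
    congr 1
    field_simp
  rw [vwpResidue, qPoch_numerator_pair hq0 hα hδ hk (qPoch_ne_zero hαδ k),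
    qPoch_numerator_pair hq0 hα hε hk (qPoch_ne_zero hαε k),
    qPoch_numerator_pair hq0 hα hφ hk (qPoch_ne_zero hαφ k),
    qPoch_denominator_pair hq0 hα hβ hk (qPoch_ne_zero hαβ k),
    qPoch_denominator_pair hq0 hα hγ hk (qPoch_ne_zero hαγ k),
    prod_erase_self_pair hq0 hα hk hαα, vwpSymTerm, vwpWeight, ← hz]
  generalize ∏ i ∈ Finset.range k, q ^ (i + 1) = T at hT
  -- Three reversals above and three below: the powers `T = q ^ (k(k+1)/2)` cancel.
  have hTT : ∀ x : ℂ, x * (T⁻¹ ^ 3 * T ^ 3) = x := fun x => by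
    rw [← mul_pow, inv_mul_cancel₀ hT, one_pow, mul_one]
  refine Eq.trans ?_ (hTT _)
  simp only [div_eq_mul_inv (_ * _ * _), div_eq_mul_inv _ T, mul_inv, inv_inv]
  ring
end Conversion

/-! ### The finite relation with denominators cleared, and its continuity. -/

section ThreeTerm

variable {q : ℂ}

/-- The conditions on the parameters under which no denominator vanishes in the symmetric form of
the three-term relation. -/
structure VWPAdmissible (q α β γ δ ε φ : ℂ) : Prop where
  ne_zero : ∀ x ∈ ({α, β, γ, δ, ε, φ} : Set ℂ), x ≠ 0
  ratio : ∀ n : ℕ, α * q ^ n ≠ β ∧ β * q ^ n ≠ α ∧ α * q ^ n ≠ γ ∧ γ * q ^ n ≠ α ∧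
    β * q ^ n ≠ γ ∧ γ * q ^ n ≠ β
  prod : ∀ n : ℕ, β ^ 2 * q ^ n ≠ 1 ∧ γ ^ 2 * q ^ n ≠ 1 ∧ β * γ * q ^ n ≠ 1
  pole : ∀ x ∈ ({α, β, γ} : Set ℂ), ∀ η ∈ ({δ, ε, φ} : Set ℂ), ∀ n : ℕ, q * x / η * q ^ n ≠ 1

theorem div_mul_pow_ne_one {x y : ℂ} (hy : y ≠ 0) (h : ∀ n : ℕ, x * q ^ n ≠ y) (n : ℕ) :
    x / y * q ^ n ≠ 1 := by
  intro h1
  field_simp at h1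
  exact h n h1

theorem mul_div_mul_pow_ne_one {x y : ℂ} (hy : y ≠ 0) (h : ∀ n : ℕ, x * q ^ n ≠ y) (n : ℕ) :
    q * x / y * q ^ n ≠ 1 := by
  rw [mul_div_assoc]
  exact mul_pow_ne_one_shift (div_mul_pow_ne_one hy h) n

/-- The difference between the first `2 N + 1` and the first `N + 1 + k` factors of `(x; q)_∞`. -/
noncomputable def qPochTail (q x : ℂ) (N k : ℕ) : ℂ :=
  qPoch q (x * q ^ (N + 1 + k)) (N - k)

theorem qPoch_mul_inv_eq_tail {x : ℂ} {N k : ℕ} (hk : k ≤ N) (h : qPoch q x (N + 1 + k) ≠ 0) :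
    qPoch q x (2 * N + 1) * (qPoch q x (N + 1 + k))⁻¹ = qPochTail q x N k := by
  rw [qPochTail, show 2 * N + 1 = N + 1 + k + (N - k) by omega, qPoch_add]
  field_simp

/-- The finite three-term sum, cleared of the denominators `(α ^ 2, α β, α γ)`. -/
noncomputable def vwpFiniteSum (q α β γ δ ε φ : ℂ) (N : ℕ) : ℂ :=
  (∑ k ∈ Finset.range (N + 1),
    vwpSymTerm q (q ^ 2 / (α * β * γ * δ * ε * φ)) α β γ δ ε φ k *
      (vwpWeight q α β γ δ ε φ N k *
        (qPochTail q (α ^ 2) N k * qPochTail q (α * β) N k * qPochTail q (α * γ) N k))) +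
  (∑ k ∈ Finset.range (N + 1),
    vwpSymTerm q (q ^ 2 / (α * β * γ * δ * ε * φ)) β γ α δ ε φ k *
      (vwpWeight q β γ α δ ε φ N k *
        ((qPoch q (β ^ 2) (N + 1 + k))⁻¹ * (qPoch q (β * γ) (N + 1 + k))⁻¹ *
          qPochTail q (α * β) N k *
          (qPoch q (α ^ 2) (2 * N + 1) * qPoch q (α * γ) (2 * N + 1))))) +
  (∑ k ∈ Finset.range (N + 1),
    vwpSymTerm q (q ^ 2 / (α * β * γ * δ * ε * φ)) γ α β δ ε φ k *
      (vwpWeight q γ α β δ ε φ N k *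
        ((qPoch q (γ ^ 2) (N + 1 + k))⁻¹ * (qPoch q (β * γ) (N + 1 + k))⁻¹ *
          qPochTail q (α * γ) N k *
          (qPoch q (α ^ 2) (2 * N + 1) * qPoch q (α * β) (2 * N + 1)))))

/-- The residue identity multiplied by `(α ^ 2, αβ, αγ)_{2N+1}`; the length `2N + 1` is the largest
value of `N + 1 + k`, so every such denominator divides out. -/
theorem vwpFiniteSum_eq_zero_of_generic (hq0 : q ≠ 0) (hq1 : ‖q‖ < 1) {α β γ δ ε φ : ℂ}
    (h : VWPAdmissible q α β γ δ ε φ) (hαα : ∀ n : ℕ, α ^ 2 * q ^ n ≠ 1)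
    (hαβ : ∀ n : ℕ, α * β * q ^ n ≠ 1) (hαγ : ∀ n : ℕ, α * γ * q ^ n ≠ 1) (N : ℕ) :
    vwpFiniteSum q α β γ δ ε φ N = 0 := by
  obtain ⟨hne, hratio, hprod, hpole⟩ := h
  simp only [Set.mem_insert_iff, Set.mem_singleton_iff, forall_eq_or_imp, forall_eq] at hne hpole
  obtain ⟨hα, hβ, hγ, hδ, hε, hφ⟩ := hne
  obtain ⟨⟨h1, h2, h3⟩, ⟨h4, h5, h6⟩, ⟨h7, h8, h9⟩⟩ := hpole
  have hβα : ∀ n : ℕ, β * α * q ^ n ≠ 1 := by simpa only [mul_comm β α] using hαβ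
  have hγα : ∀ n : ℕ, γ * α * q ^ n ≠ 1 := by simpa only [mul_comm γ α] using hαγ
  have hβγ : ∀ n : ℕ, β * γ * q ^ n ≠ 1 := fun n => (hprod n).2.2
  have hγβ : ∀ n : ℕ, γ * β * q ^ n ≠ 1 := by simpa only [mul_comm γ β] using hβγ
  have hββ : ∀ n : ℕ, β ^ 2 * q ^ n ≠ 1 := fun n => (hprod n).1
  have hγγ : ∀ n : ℕ, γ ^ 2 * q ^ n ≠ 1 := fun n => (hprod n).2.1
  have key := sum_vwpResidue_eq_zero hq0 hq1 (p := ![α, β, γ])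
    (by intro i; fin_cases i <;> assumption)
    (by
      intro i j
      fin_cases i <;> fin_cases j <;> simp [← sq] <;> assumption)
    (by
      intro i j hij n
      obtain ⟨r1, r2, r3, r4, r5, r6⟩ := hratio n
      fin_cases i <;> fin_cases j <;> first | exact absurd rfl hij | assumption)
    δ ε φ N
  simp only [Matrix.cons_val_zero, Matrix.cons_val_one, Matrix.cons_val_two, Matrix.head_cons,
    Matrix.tail_cons] at key
  rw [← mul_zero (qPoch q (α ^ 2) (2 * N + 1) * qPoch q (α * β) (2 * N + 1) *
    qPoch q (α * γ) (2 * N + 1)), ← key, mul_add, mul_add, Finset.mul_sum, Finset.mul_sum,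
    Finset.mul_sum, vwpFiniteSum]
  congr 1
  congr 1
  all_goals refine Finset.sum_congr rfl fun k hk => ?_
  all_goals have hk : k ≤ N := by simpa [Nat.lt_succ_iff] using hk
  · rw [vwpResidue_eq hq0 hα hβ hγ hδ hε hφ hαα hαβ hαγ h1 h2 h3 hk,
      ← qPoch_mul_inv_eq_tail hk (qPoch_ne_zero hαα _),
      ← qPoch_mul_inv_eq_tail hk (qPoch_ne_zero hαβ _),
      ← qPoch_mul_inv_eq_tail hk (qPoch_ne_zero hαγ _)]
    ring
  · rw [vwpResidue_eq hq0 hβ hγ hα hδ hε hφ hββ hβγ hβα h4 h5 h6 hk,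
      ← qPoch_mul_inv_eq_tail hk (qPoch_ne_zero hαβ _), mul_comm β α,
      show β * γ * α * δ * ε * φ = α * β * γ * δ * ε * φ by ring]
    ring
  · rw [vwpResidue_eq hq0 hγ hα hβ hδ hε hφ hγγ hγα hγβ h7 h8 h9 hk,
      ← qPoch_mul_inv_eq_tail hk (qPoch_ne_zero hαγ _), mul_comm γ α, mul_comm γ β,
      show α * γ * β * δ * ε * φ = α * β * γ * δ * ε * φ by ring]
    ring

theorem continuous_qPoch (q : ℂ) (n : ℕ) : Continuous fun x => qPoch q x n := by
  unfold qPoch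
  fun_prop

theorem ContinuousAt.qPoch {X : Type*} [TopologicalSpace X] {f : X → ℂ} {x : X}
    (hf : ContinuousAt f x) (n : ℕ) : ContinuousAt (fun y => qPoch q (f y) n) x :=
  (continuous_qPoch q n).continuousAt.comp hf

theorem ContinuousAt.qPoch_inv {X : Type*} [TopologicalSpace X] {f : X → ℂ} {x : X}
    (hf : ContinuousAt f x) (h : ∀ n : ℕ, f x * q ^ n ≠ 1) (n : ℕ) :
    ContinuousAt (fun y => (_root_.qPoch q (f y) n)⁻¹) x :=
  (hf.qPoch n).inv₀ (qPoch_ne_zero h n)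

theorem continuousAt_vwpSymTerm {X : Type*} [TopologicalSpace X] {z α β γ δ ε φ : X → ℂ} {x : X}
    (hz : ContinuousAt z x) (hα : ContinuousAt α x) (hβ : ContinuousAt β x)
    (hγ : ContinuousAt γ x) (hδ : ContinuousAt δ x) (hε : ContinuousAt ε x)
    (hφ : ContinuousAt φ x) (hq1 : ‖q‖ < 1)
    (h0 : β x ≠ 0 ∧ γ x ≠ 0 ∧ δ x ≠ 0 ∧ ε x ≠ 0 ∧ φ x ≠ 0)
    (hαβ : ∀ n : ℕ, q * α x / β x * q ^ n ≠ 1) (hαγ : ∀ n : ℕ, q * α x / γ x * q ^ n ≠ 1)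
    (hαδ : ∀ n : ℕ, q * α x / δ x * q ^ n ≠ 1) (hαε : ∀ n : ℕ, q * α x / ε x * q ^ n ≠ 1)
    (hαφ : ∀ n : ℕ, q * α x / φ x * q ^ n ≠ 1) (k : ℕ) :
    ContinuousAt (fun y => vwpSymTerm q (z y) (α y) (β y) (γ y) (δ y) (ε y) (φ y) k) x := by
  obtain ⟨h1, h2, h3, h4, h5⟩ := h0
  have c := hα.const_mul q
  exact (((continuousAt_const.sub ((hα.pow 2).mul_const _)).mul
    (((hα.pow 2).qPoch k).mul ((((((hα.mul hβ).qPoch k).mul ((hα.mul hγ).qPoch k)).mul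
      ((hα.mul hδ).qPoch k)).mul ((hα.mul hε).qPoch k)).mul ((hα.mul hφ).qPoch k)))).mul
    ((continuousAt_const.qPoch_inv (self_mul_pow_ne_one hq1) k).mul
      ((((((c.div hβ h1).qPoch_inv hαβ k).mul ((c.div hγ h2).qPoch_inv hαγ k)).mul
        ((c.div hδ h3).qPoch_inv hαδ k)).mul ((c.div hε h4).qPoch_inv hαε k)).mul
        ((c.div hφ h5).qPoch_inv hαφ k)))).mul (hz.pow k)

theorem continuousAt_vwpWeight {X : Type*} [TopologicalSpace X] {α β γ : X → ℂ} {x : X}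
    (hα : ContinuousAt α x) (hβ : ContinuousAt β x) (hγ : ContinuousAt γ x) (hq1 : ‖q‖ < 1)
    {δ ε φ : ℂ} (h0 : α x ≠ 0 ∧ δ ≠ 0 ∧ ε ≠ 0 ∧ φ ≠ 0)
    (hβα : ∀ n : ℕ, β x / α x * q ^ n ≠ 1) (hγα : ∀ n : ℕ, γ x / α x * q ^ n ≠ 1) (N k : ℕ) :
    ContinuousAt (fun y => vwpWeight q (α y) (β y) (γ y) δ ε φ N k) x := by
  obtain ⟨h1, h2, h3, h4⟩ := h0
  have c := hα.const_mul q
  have cη : ∀ η : ℂ, η ≠ 0 → ContinuousAt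
      (fun y => qPoch q (q * α y / η) (N + k) * qPoch q (q / (α y * η)) (N - k)) x := fun η hη =>
    ((c.div_const η).qPoch _).mul
      ((continuousAt_const.div (hα.mul_const η) (mul_ne_zero h1 hη)).qPoch _)
  exact ((((hα.inv₀ h1).mul (cη δ h2)).mul (cη ε h3)).mul (cη φ h4)).mul
    (((continuousAt_const.qPoch_inv (self_mul_pow_ne_one hq1) _).mul
      ((hβ.div hα h1).qPoch_inv hβα _)).mul ((hγ.div hα h1).qPoch_inv hγα _))

end ThreeTerm

/-! ### Removing genericity, and the limit `N → ∞`. -/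

section ThreeTermLimit

variable {q : ℂ}

theorem continuousAt_vwpFiniteSum (hq1 : ‖q‖ < 1) {α β γ δ ε φ : ℂ}
    (h : VWPAdmissible q α β γ δ ε φ) (N : ℕ) :
    ContinuousAt (fun x => vwpFiniteSum q x β γ δ ε φ N) α := by
  obtain ⟨hne, hratio, hprod, hpole⟩ := h
  simp only [Set.mem_insert_iff, Set.mem_singleton_iff, forall_eq_or_imp, forall_eq] at hne hpole
  obtain ⟨hα, hβ, hγ, hδ, hε, hφ⟩ := hne
  obtain ⟨⟨h1, h2, h3⟩, ⟨h4, h5, h6⟩, ⟨h7, h8, h9⟩⟩ := hpole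
  have r1 : ∀ n : ℕ, α * q ^ n ≠ β := fun n => (hratio n).1
  have r2 : ∀ n : ℕ, β * q ^ n ≠ α := fun n => (hratio n).2.1
  have r3 : ∀ n : ℕ, α * q ^ n ≠ γ := fun n => (hratio n).2.2.1
  have r4 : ∀ n : ℕ, γ * q ^ n ≠ α := fun n => (hratio n).2.2.2.1
  have r5 : ∀ n : ℕ, β * q ^ n ≠ γ := fun n => (hratio n).2.2.2.2.1
  have r6 : ∀ n : ℕ, γ * q ^ n ≠ β := fun n => (hratio n).2.2.2.2.2
  have c : ContinuousAt (fun x : ℂ => x) α := continuousAt_id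
  have k0 : ∀ y : ℂ, ContinuousAt (fun _ : ℂ => y) α := fun _ => continuousAt_const
  have hz : ContinuousAt (fun x => q ^ 2 / (x * β * γ * δ * ε * φ)) α :=
    (k0 _).div (by fun_prop) (by positivity)
  have cs := c.pow 2
  have cp : ∀ y n, ContinuousAt (fun x : ℂ => qPoch q (x * y) n) α := fun y n =>
    (c.mul_const y).qPoch n
  have ct : ∀ y k, ContinuousAt (fun x : ℂ => qPochTail q (x * y) N k) α := fun y k =>
    ((c.mul_const y).mul_const _).qPoch _
  refine ContinuousAt.add (ContinuousAt.add ?_ ?_) ?_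
  all_goals refine tendsto_finsetSum _ fun k _ => ?_
  · exact (continuousAt_vwpSymTerm hz c (k0 β) (k0 γ) (k0 δ) (k0 ε) (k0 φ) hq1
      ⟨hβ, hγ, hδ, hε, hφ⟩ (mul_div_mul_pow_ne_one hβ r1) (mul_div_mul_pow_ne_one hγ r3)
      h1 h2 h3 k).mul ((continuousAt_vwpWeight c (k0 β) (k0 γ) hq1 ⟨hα, hδ, hε, hφ⟩
      (div_mul_pow_ne_one hα r2) (div_mul_pow_ne_one hα r4) N k).mul
      (((((cs.mul_const _).qPoch _ : ContinuousAt (fun x => qPochTail q (x ^ 2) N k) α)).mul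
        (ct β k)).mul (ct γ k)))
  · exact (continuousAt_vwpSymTerm hz (k0 β) (k0 γ) c (k0 δ) (k0 ε) (k0 φ) hq1
      ⟨hγ, hα, hδ, hε, hφ⟩ (mul_div_mul_pow_ne_one hγ r5) (mul_div_mul_pow_ne_one hα r2)
      h4 h5 h6 k).mul ((continuousAt_vwpWeight (k0 β) (k0 γ) c hq1 ⟨hβ, hδ, hε, hφ⟩
      (div_mul_pow_ne_one hβ r6) (div_mul_pow_ne_one hβ r1) N k).mul
      (((k0 _).mul (ct β k)).mul ((cs.qPoch _).mul (cp γ _))))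
  · exact (continuousAt_vwpSymTerm hz (k0 γ) c (k0 β) (k0 δ) (k0 ε) (k0 φ) hq1
      ⟨hα, hβ, hδ, hε, hφ⟩ (mul_div_mul_pow_ne_one hα r4) (mul_div_mul_pow_ne_one hβ r6)
      h7 h8 h9 k).mul ((continuousAt_vwpWeight (k0 γ) c (k0 β) hq1 ⟨hγ, hδ, hε, hφ⟩
      (div_mul_pow_ne_one hγ r3) (div_mul_pow_ne_one hγ r5) N k).mul
      (((k0 _).mul (ct γ k)).mul ((cs.qPoch _).mul (cp β _))))

/-- With the other parameters fixed, the generic identity fails to apply only for countably many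
values of the first one. Their complement is dense, and continuity at `α` finishes. -/
theorem vwpFiniteSum_eq_zero (hq0 : q ≠ 0) (hq1 : ‖q‖ < 1) {α β γ δ ε φ : ℂ}
    (h : VWPAdmissible q α β γ δ ε φ) (N : ℕ) : vwpFiniteSum q α β γ δ ε φ N = 0 := by
  have hcont := continuousAt_vwpFiniteSum hq1 h N
  obtain ⟨hne, hratio, hprod, hpole⟩ := h
  simp only [Set.mem_insert_iff, Set.mem_singleton_iff, forall_eq_or_imp, forall_eq] at hne hpole
  obtain ⟨-, hβ, hγ, hδ, hε, hφ⟩ := hne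
  -- The values `± r n` are the solutions of `x ^ 2 * q ^ n = 1`.
  choose r hr using fun n : ℕ => IsAlgClosed.exists_pow_nat_eq (q ^ n)⁻¹ two_pos
  set S : Set ℂ := ⋃ n : ℕ, {0, r n, -r n, (β * q ^ n)⁻¹, (γ * q ^ n)⁻¹, β / q ^ n, β * q ^ n,
    γ / q ^ n, γ * q ^ n, δ / (q * q ^ n), ε / (q * q ^ n), φ / (q * q ^ n)} with hS
  have hScount : S.Countable := Set.countable_iUnion fun n => (Set.toFinite _).countable
  have hgen : ∀ x ∈ Sᶜ, vwpFiniteSum q x β γ δ ε φ N = 0 := by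
    intro x hx
    have hx' : ∀ n : ℕ, x ≠ 0 ∧ x ≠ r n ∧ x ≠ -r n ∧ x ≠ (β * q ^ n)⁻¹ ∧ x ≠ (γ * q ^ n)⁻¹ ∧
        x ≠ β / q ^ n ∧ x ≠ β * q ^ n ∧ x ≠ γ / q ^ n ∧ x ≠ γ * q ^ n ∧ x ≠ δ / (q * q ^ n) ∧
        x ≠ ε / (q * q ^ n) ∧ x ≠ φ / (q * q ^ n) := by
      simpa [hS, not_or] using hx
    have hqn : ∀ n : ℕ, q ^ n ≠ 0 := fun n => pow_ne_zero n hq0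
    have hxη : ∀ η : ℂ, η ≠ 0 → ∀ n : ℕ, x ≠ η / (q * q ^ n) → q * x / η * q ^ n ≠ 1 := by
      intro η hη n hn h
      refine hn (eq_div_of_mul_eq (mul_ne_zero hq0 (hqn n)) ?_)
      field_simp at h
      linear_combination h
    refine vwpFiniteSum_eq_zero_of_generic hq0 hq1 ⟨?_, fun n => ?_, hprod, ?_⟩ (fun n => ?_)
      (fun n => ?_) (fun n => ?_) N
    · simp only [Set.mem_insert_iff, Set.mem_singleton_iff, forall_eq_or_imp, forall_eq]
      exact ⟨(hx' 0).1, hβ, hγ, hδ, hε, hφ⟩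
    · obtain ⟨-, -, -, -, -, h1, h2, h3, h4, -⟩ := hx' n
      exact ⟨fun h => h1 (eq_div_of_mul_eq (hqn n) h), h2.symm,
        fun h => h3 (eq_div_of_mul_eq (hqn n) h), h4.symm, (hratio n).2.2.2.2⟩
    · simp only [Set.mem_insert_iff, Set.mem_singleton_iff, forall_eq_or_imp, forall_eq]
      refine ⟨⟨fun n => ?_, fun n => ?_, fun n => ?_⟩, hpole.2⟩
      · exact hxη δ hδ n (hx' n).2.2.2.2.2.2.2.2.2.1
      · exact hxη ε hε n (hx' n).2.2.2.2.2.2.2.2.2.2.1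
      · exact hxη φ hφ n (hx' n).2.2.2.2.2.2.2.2.2.2.2
    · intro h
      have : x ^ 2 = r n ^ 2 := by rw [hr]; exact eq_inv_of_mul_eq_one_left h
      rcases sq_eq_sq_iff_eq_or_eq_neg.1 this with h | h
      · exact (hx' n).2.1 h
      · exact (hx' n).2.2.1 h
    · intro h
      exact (hx' n).2.2.2.1 (eq_inv_of_mul_eq_one_left (by rw [← h]; ring))
    · intro h
      exact (hx' n).2.2.2.2.1 (eq_inv_of_mul_eq_one_left (by rw [← h]; ring))
  have hmem : α ∈ closure Sᶜ := hScount.dense_compl ℝ α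
  have := mem_closure_iff_nhdsWithin_neBot.1 hmem
  refine tendsto_nhds_unique (hcont.tendsto.mono_left nhdsWithin_le_nhds)
    (tendsto_const_nhds.congr' (f₁ := fun _ => (0 : ℂ)) (l₁ := 𝓝[Sᶜ] α) ?_)
  filter_upwards [self_mem_nhdsWithin] with x hx
  exact (hgen x hx).symm

/-- The coefficient of `z ^ k` converges, hence is bounded, and the geometric series dominates. -/
theorem summable_vwpSymTerm (hq1 : ‖q‖ < 1) {z : ℂ} (hz : ‖z‖ < 1) {α β γ δ ε φ : ℂ}
    (hαβ : ∀ n : ℕ, q * α / β * q ^ n ≠ 1) (hαγ : ∀ n : ℕ, q * α / γ * q ^ n ≠ 1)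
    (hαδ : ∀ n : ℕ, q * α / δ * q ^ n ≠ 1) (hαε : ∀ n : ℕ, q * α / ε * q ^ n ≠ 1)
    (hαφ : ∀ n : ℕ, q * α / φ * q ^ n ≠ 1) : Summable (vwpSymTerm q z α β γ δ ε φ) := by
  have t := tendsto_qPoch hq1
  have ti : ∀ {x : ℂ}, (∀ n : ℕ, x * q ^ n ≠ 1) →
      Tendsto (fun n => (qPoch q x n)⁻¹) atTop (𝓝 (qPochInf q x)⁻¹) := fun hx =>
    (t _).inv₀ (qPochInf_ne_zero hq1 hx)
  have hq : Tendsto (fun k : ℕ => q ^ (2 * k)) atTop (𝓝 0) :=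
    (tendsto_pow_atTop_nhds_zero_of_norm_lt_one hq1).comp
      (tendsto_atTop_mono (fun k => by simp only [id]; omega) tendsto_id)
  have hlim := ((hq.const_mul (α ^ 2)).const_sub 1).mul ((t (α ^ 2)).mul
    (((((t (α * β)).mul (t (α * γ))).mul (t (α * δ))).mul (t (α * ε))).mul (t (α * φ)))) |>.mul
    ((ti (self_mul_pow_ne_one hq1)).mul
      (((((ti hαβ).mul (ti hαγ)).mul (ti hαδ)).mul (ti hαε)).mul (ti hαφ)))
  obtain ⟨C, hC⟩ := (Metric.isBounded_range_of_tendsto _ hlim).exists_norm_le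
  refine Summable.of_norm_bounded
    ((summable_geometric_of_lt_one (norm_nonneg z) hz).mul_left C) fun k => ?_
  rw [vwpSymTerm, norm_mul, norm_pow]
  exact mul_le_mul_of_nonneg_right (hC _ ⟨k, rfl⟩) (by positivity)

/-- The limit of `vwpWeight` as `N → ∞`. -/
noncomputable def vwpWeightInf (q α β γ δ ε φ : ℂ) : ℂ :=
  α⁻¹ * (qPochInf q (q * α / δ) * qPochInf q (q / (α * δ))) *
    (qPochInf q (q * α / ε) * qPochInf q (q / (α * ε))) *
    (qPochInf q (q * α / φ) * qPochInf q (q / (α * φ))) *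
    ((qPochInf q q)⁻¹ * (qPochInf q (β / α))⁻¹ * (qPochInf q (γ / α))⁻¹)

theorem boundedTendsto_vwpWeight (hq1 : ‖q‖ < 1) {α β γ : ℂ} (δ ε φ : ℂ)
    (hβα : ∀ n : ℕ, β / α * q ^ n ≠ 1) (hγα : ∀ n : ℕ, γ / α * q ^ n ≠ 1) :
    BoundedTendsto (vwpWeight q α β γ δ ε φ) (vwpWeightInf q α β γ δ ε φ) := by
  have m1 : ∀ k, Tendsto (fun N : ℕ => N + k) atTop atTop := fun k => tendsto_add_atTop_nat k
  have m2 : ∀ k, Tendsto (fun N : ℕ => N - k) atTop atTop := fun k => tendsto_sub_atTop_nat k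
  have m3 : ∀ k, Tendsto (fun N : ℕ => N + 1 - k) atTop atTop := fun k =>
    (m2 k).comp (m1 1)
  have hη : ∀ η, BoundedTendsto
      (fun N k => qPoch q (q * α / η) (N + k) * qPoch q (q / (α * η)) (N - k)) _ := fun η =>
    (boundedTendsto_qPoch hq1 (q * α / η) m1).mul (boundedTendsto_qPoch hq1 (q / (α * η)) m2)
  exact ((((BoundedTendsto.const α⁻¹).mul (hη δ)).mul (hη ε)).mul (hη φ)).mul
    (((boundedTendsto_qPoch_inv hq1 (self_mul_pow_ne_one hq1) m2).mul
      (boundedTendsto_qPoch_inv hq1 hβα m3)).mul (boundedTendsto_qPoch_inv hq1 hγα m3))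

/-- The three-term relation in symmetric form. -/
theorem sum_tsum_vwpSymTerm_eq_zero (hq0 : q ≠ 0) (hq1 : ‖q‖ < 1) {z α β γ δ ε φ : ℂ}
    (h : VWPAdmissible q α β γ δ ε φ) (hz : z = q ^ 2 / (α * β * γ * δ * ε * φ))
    (hα : Summable (vwpSymTerm q z α β γ δ ε φ)) (hβ : Summable (vwpSymTerm q z β γ α δ ε φ))
    (hγ : Summable (vwpSymTerm q z γ α β δ ε φ)) :
    (∑' k, vwpSymTerm q z α β γ δ ε φ k) * vwpWeightInf q α β γ δ ε φ +
      (∑' k, vwpSymTerm q z β γ α δ ε φ k) * (vwpWeightInf q β γ α δ ε φ *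
        ((qPochInf q (β ^ 2))⁻¹ * (qPochInf q (β * γ))⁻¹ *
          (qPochInf q (α ^ 2) * qPochInf q (α * γ)))) +
      (∑' k, vwpSymTerm q z γ α β δ ε φ k) * (vwpWeightInf q γ α β δ ε φ *
        ((qPochInf q (γ ^ 2))⁻¹ * (qPochInf q (β * γ))⁻¹ *
          (qPochInf q (α ^ 2) * qPochInf q (α * β)))) = 0 := by
  have hfin := vwpFiniteSum_eq_zero hq0 hq1 h
  obtain ⟨hne, hratio, hprod, -⟩ := h
  simp only [Set.mem_insert_iff, Set.mem_singleton_iff, forall_eq_or_imp, forall_eq] at hne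
  obtain ⟨hα0, hβ0, hγ0, -⟩ := hne
  have r1 := div_mul_pow_ne_one hβ0 fun n => (hratio n).1
  have r2 := div_mul_pow_ne_one hα0 fun n => (hratio n).2.1
  have r3 := div_mul_pow_ne_one hγ0 fun n => (hratio n).2.2.1
  have r4 := div_mul_pow_ne_one hα0 fun n => (hratio n).2.2.2.1
  have r5 := div_mul_pow_ne_one hγ0 fun n => (hratio n).2.2.2.2.1
  have r6 := div_mul_pow_ne_one hβ0 fun n => (hratio n).2.2.2.2.2
  have m1 : ∀ k, Tendsto (fun N : ℕ => N + 1 + k) atTop atTop := fun k =>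
    (tendsto_add_atTop_nat k).comp (tendsto_add_atTop_nat 1)
  have m2 : ∀ _ : ℕ, Tendsto (fun N : ℕ => 2 * N + 1) atTop atTop := fun _ =>
    tendsto_atTop_mono (fun N => by simp only [id]; omega) tendsto_id
  have tl : ∀ x, BoundedTendsto (qPochTail q x) 1 := boundedTendsto_qPoch_tail hq1
  have hA := ((boundedTendsto_vwpWeight hq1 δ ε φ r2 r4).mul
    (((tl (α ^ 2)).mul (tl (α * β))).mul (tl (α * γ)))).tendsto_sum hα
  have hB := ((boundedTendsto_vwpWeight hq1 δ ε φ r6 r1).mul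
    ((((boundedTendsto_qPoch_inv hq1 (fun n => (hprod n).1) m1).mul
      (boundedTendsto_qPoch_inv hq1 (fun n => (hprod n).2.2) m1)).mul (tl (α * β))).mul
      ((boundedTendsto_qPoch hq1 (α ^ 2) m2).mul
        (boundedTendsto_qPoch hq1 (α * γ) m2)))).tendsto_sum hβ
  have hC := ((boundedTendsto_vwpWeight hq1 δ ε φ r3 r5).mul
    ((((boundedTendsto_qPoch_inv hq1 (fun n => (hprod n).2.1) m1).mul
      (boundedTendsto_qPoch_inv hq1 (fun n => (hprod n).2.2) m1)).mul (tl (α * γ))).mul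
      ((boundedTendsto_qPoch hq1 (α ^ 2) m2).mul
        (boundedTendsto_qPoch hq1 (α * β) m2)))).tendsto_sum hγ
  have hlim := (hA.add hB).add hC
  subst hz
  have h0 := tendsto_nhds_unique hlim (tendsto_const_nhds.congr fun N => (hfin N).symm)
  simpa only [mul_one] using h0

end ThreeTermLimit

/-! ### Return to the original parameters. -/

section Main

variable {q : ℂ}

theorem vwpTerm_sq {α : ℂ} (hα : α ≠ 0) (z β γ δ ε φ : ℂ) (k : ℕ) :
    vwpTerm q (α ^ 2) [α * β, α * γ, α * δ, α * ε, α * φ] z k =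
      (1 - α ^ 2)⁻¹ * vwpSymTerm q z α β γ δ ε φ k := by
  have h : ∀ x : ℂ, q * α ^ 2 / (α * x) = q * α / x := fun x => by
    rw [sq, ← mul_assoc, mul_comm α x, mul_div_mul_right _ _ hα]
  simp only [vwpTerm, List.map_cons, List.map_nil, List.prod_cons, List.prod_nil, h, vwpSymTerm]
  simp only [div_eq_mul_inv, mul_inv, inv_one]
  ring

theorem vwpSymTerm_rotate (q z β γ α δ ε φ : ℂ) :
    vwpSymTerm q z β α ε γ δ φ = vwpSymTerm q z β γ α δ ε φ := by
  funext k
  simp only [vwpSymTerm]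
  ring

theorem vwpSymTerm_swap (q z β γ α δ ε φ : ℂ) :
    vwpSymTerm q z β γ α δ ε φ = vwpSymTerm q z β α γ δ ε φ := by
  funext k
  simp only [vwpSymTerm]
  ring

theorem vwpWeightInf_swap (q β γ α δ ε φ : ℂ) :
    vwpWeightInf q β γ α δ ε φ = vwpWeightInf q β α γ δ ε φ := by
  simp only [vwpWeightInf]
  ring

/-- For `b/a` and `c/a` the hypotheses exclude only `q ^ (-n)` with `n ≥ 1`, through `qb/a` and
`qc/a`; the case `n = 0` has to be supplied separately. -/
theorem mul_pow_ne_of_div {x y : ℂ} (hy : y ≠ 0) (hxy : x ≠ y)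
    (h : ∀ n : ℕ, q * x / y * q ^ n ≠ 1) (n : ℕ) : x * q ^ n ≠ y := by
  intro h1
  rcases n with - | n
  · exact hxy (by simpa using h1)
  · refine h n ?_
    rw [div_mul_eq_mul_div, div_eq_one_iff_eq hy, ← h1, pow_succ']
    ring

theorem vwpSeries_sq {α : ℂ} (hα : α ≠ 0) (hα1 : α ^ 2 ≠ 1) (z β γ δ ε φ : ℂ) :
    ∑' k, vwpSymTerm q z α β γ δ ε φ k =
      (1 - α ^ 2) * vwpSeries q (α ^ 2) [α * β, α * γ, α * δ, α * ε, α * φ] z := by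
  rw [vwpSeries, ← tsum_mul_left]
  refine tsum_congr fun k => ?_
  rw [vwpTerm_sq hα, mul_inv_cancel_left₀ (sub_ne_zero.2 hα1.symm)]

/-- Identifies `K(b, c)` as minus the quotient of the factors of the `β`- and `α`-series in the
symmetric relation. The factors `1 - α ^ 2` and `1 - β ^ 2` normalise the series and turn `(α ^
2)_∞, (β ^ 2)_∞` into `(qα ^ 2)_∞, (qβ ^ 2)_∞`. -/
theorem threeTermCoeff_mul (hq1 : ‖q‖ < 1) {α β γ δ ε φ : ℂ} (hα : α ≠ 0) (hβ : β ≠ 0)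
    (hβ1 : β ^ 2 ≠ 1) (hββ : ∀ n : ℕ, β ^ 2 * q ^ n ≠ 1)
    (hβα : ∀ n : ℕ, β / α * q ^ n ≠ 1) (hγα : ∀ n : ℕ, γ / α * q ^ n ≠ 1)
    (h1 : ∀ n : ℕ, q * α / δ * q ^ n ≠ 1) (h2 : ∀ n : ℕ, q * α / ε * q ^ n ≠ 1)
    (h3 : ∀ n : ℕ, q * α / φ * q ^ n ≠ 1) (h4 : ∀ n : ℕ, q / (α * δ) * q ^ n ≠ 1)
    (h5 : ∀ n : ℕ, q / (α * ε) * q ^ n ≠ 1) (h6 : ∀ n : ℕ, q / (α * φ) * q ^ n ≠ 1) :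
    threeTermCoeff q (α ^ 2) (α * β) (α * γ) (α * δ) (α * ε) (α * φ) *
      ((1 - α ^ 2) * vwpWeightInf q α β γ δ ε φ) =
    -((1 - β ^ 2) * (vwpWeightInf q β γ α δ ε φ *
        ((qPochInf q (β ^ 2))⁻¹ * (qPochInf q (β * γ))⁻¹ *
          (qPochInf q (α ^ 2) * qPochInf q (α * γ))))) := by
  have e1 : ∀ x, α * x / α ^ 2 = x / α := fun x => by field_simp
  have e2 : ∀ x, α ^ 2 / (α * x) = α / x := fun x => by
    rw [sq, mul_div_mul_left _ _ hα]
  have e3 : ∀ x, q * α ^ 2 / (α * x) = q * α / x := fun x => by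
    rw [sq, ← mul_assoc, mul_comm α x, mul_div_mul_right _ _ hα]
  have e4 : ∀ x, q * α ^ 2 / (α * β * (α * x)) = q / (β * x) := fun x => by
    rw [show α * β * (α * x) = β * x * α ^ 2 by ring, mul_div_mul_right _ _ (pow_ne_zero 2 hα)]
  have e5 : ∀ x y, α * x / (α * y) = x / y := fun x y => mul_div_mul_left _ _ hα
  have e6 : ∀ x, q * (α * β) / (α * x) = q * β / x := fun x => by
    rw [mul_left_comm, mul_div_mul_left _ _ hα]
  have e7 : α * β * (α * γ) / α ^ 2 = β * γ := by field_simp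
  have e8 : q * (α * β) ^ 2 / α ^ 2 = q * β ^ 2 := by field_simp
  have n1 := qPochInf_ne_zero hq1 h1
  have n2 := qPochInf_ne_zero hq1 h2
  have n3 := qPochInf_ne_zero hq1 h3
  have n4 := qPochInf_ne_zero hq1 h4
  have n5 := qPochInf_ne_zero hq1 h5
  have n6 := qPochInf_ne_zero hq1 h6
  have n7 := qPochInf_ne_zero hq1 hβα
  have n8 := qPochInf_ne_zero hq1 hγα
  have n9 : 1 - β ^ 2 ≠ 0 := sub_ne_zero.2 hβ1.symm
  have n10 := qPochInf_ne_zero hq1 (mul_pow_ne_one_shift hββ)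
  simp only [threeTermCoeff, vwpWeightInf, List.map_cons, List.map_nil, List.prod_cons,
    List.prod_nil, e1, e2, e3, e4, e5, e6, e7, e8, qPochInf_eq_mul hq1 (α ^ 2),
    qPochInf_eq_mul hq1 (β ^ 2)]
  clear e1 e2 e3 e4 e5 e6 e7 e8 h1 h2 h3 h4 h5 h6 hβα hγα hββ hβ1
  generalize qPochInf q (q * α / δ) = x1 at *
  generalize qPochInf q (q * α / ε) = x2 at *
  generalize qPochInf q (q * α / φ) = x3 at *
  generalize qPochInf q (q / (α * δ)) = x4 at *
  generalize qPochInf q (q / (α * ε)) = x5 at *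
  generalize qPochInf q (q / (α * φ)) = x6 at *
  generalize qPochInf q (β / α) = x7 at *
  generalize qPochInf q (γ / α) = x8 at *
  generalize qPochInf q (q * β ^ 2) = x9 at *
  generalize 1 - β ^ 2 = y at *
  generalize 1 - α ^ 2 = w at *
  -- The cancelling pairs are inserted explicitly on both sides, so that `ring` needs no
  -- nonvanishing facts.
  have hX : ∀ x : ℂ, x * ((x1⁻¹ * x1) * (x2⁻¹ * x2) * (x3⁻¹ * x3) * (x4⁻¹ * x4) * (x5⁻¹ * x5) *
      (x6⁻¹ * x6) * (x7⁻¹ * x7) * (x8⁻¹ * x8) * (α⁻¹ * α)) = x * (y⁻¹ * y) := fun x => by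
    simp only [inv_mul_cancel₀, n1, n2, n3, n4, n5, n6, n7, n8, n9, hα, ne_eq, not_false_eq_true,
      mul_one]
  have hY : ∀ x : ℂ, x * (y⁻¹ * y) = x := fun x => by rw [inv_mul_cancel₀ n9, mul_one]
  simp only [div_eq_mul_inv, mul_inv]
  rw [← hY (_ * (w * _))]
  refine Eq.trans ?_ ((hX _).trans (hY _))
  ring

end Main

theorem mainTheorem4 (q : ℂ) (hq0 : q ≠ 0) (hq1 : ‖q‖ < 1) (a b c d e f : ℂ)
    -- the parameters are nonzero and the argument lies in the disc of convergence
    (ha : a ≠ 0) (hb : b ≠ 0) (hc : c ≠ 0) (hd : d ≠ 0) (he : e ≠ 0) (hf : f ≠ 0)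
    (hz : ‖q ^ 2 * a ^ 2 / (b * c * d * e * f)‖ < 1)
    -- no denominator in the relation vanishes
    (ha1 : a ≠ 1)
    (hden : ∀ x ∈ ({a / b, a / c, b / c, c / b, b * c / a, b ^ 2 / a, c ^ 2 / a,
        q * b / a, q * c / a} : Set ℂ), ∀ n : ℕ, x * q ^ n ≠ 1)
    (hdenη : ∀ η ∈ ({d, e, f} : Set ℂ), ∀ x ∈ ({q / η, q * a / η, q * b / η, q * c / η} : Set ℂ),
      ∀ n : ℕ, x * q ^ n ≠ 1) :
    Summable (vwpTerm q a [b, c, d, e, f] (q ^ 2 * a ^ 2 / (b * c * d * e * f))) ∧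
    Summable (vwpTerm q (b ^ 2 / a) [b, b * e / a, b * c / a, b * d / a, b * f / a]
      (q ^ 2 * a ^ 2 / (b * c * d * e * f))) ∧
    Summable (vwpTerm q (c ^ 2 / a) [c, c * e / a, c * b / a, c * d / a, c * f / a]
      (q ^ 2 * a ^ 2 / (b * c * d * e * f))) ∧
    vwpSeries q a [b, c, d, e, f] (q ^ 2 * a ^ 2 / (b * c * d * e * f)) =
      threeTermCoeff q a b c d e f *
          vwpSeries q (b ^ 2 / a) [b, b * e / a, b * c / a, b * d / a, b * f / a]
            (q ^ 2 * a ^ 2 / (b * c * d * e * f)) +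
        threeTermCoeff q a c b d e f *
          vwpSeries q (c ^ 2 / a) [c, c * e / a, c * b / a, c * d / a, c * f / a]
            (q ^ 2 * a ^ 2 / (b * c * d * e * f)) := by
  obtain ⟨α, rfl⟩ : ∃ α : ℂ, a = α ^ 2 :=
    (IsAlgClosed.exists_pow_nat_eq a two_pos).imp fun _ h => h.symm
  have hα : α ≠ 0 := fun h => ha (by simp [h])
  have hmul : ∀ x : ℂ, ∃ y : ℂ, x = α * y := fun x => ⟨x / α, by field_simp⟩
  obtain ⟨β, rfl⟩ := hmul b
  obtain ⟨γ, rfl⟩ := hmul c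
  obtain ⟨δ, rfl⟩ := hmul d
  obtain ⟨ε, rfl⟩ := hmul e
  obtain ⟨φ, rfl⟩ := hmul f
  have hβ := right_ne_zero_of_mul hb
  have hγ := right_ne_zero_of_mul hc
  have hδ := right_ne_zero_of_mul hd
  have hε := right_ne_zero_of_mul he
  have hφ := right_ne_zero_of_mul hf
  have e1 : ∀ x, q * (α * x) / α ^ 2 = q * x / α := fun x => by field_simp
  have e2 : ∀ x, α ^ 2 / (α * x) = α / x := fun x => by rw [sq, mul_div_mul_left _ _ hα]
  have e3 : ∀ x, q * α ^ 2 / (α * x) = q * α / x := fun x => by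
    rw [sq, ← mul_assoc, mul_comm α x, mul_div_mul_right _ _ hα]
  have e5 : ∀ x y, α * x / (α * y) = x / y := fun x y => mul_div_mul_left _ _ hα
  have e6 : ∀ x y, q * (α * x) / (α * y) = q * x / y := fun x y => by
    rw [mul_left_comm, mul_div_mul_left _ _ hα]
  have e7 : ∀ x y, α * x * (α * y) / α ^ 2 = x * y := fun x y => by field_simp
  have e8 : ∀ x, (α * x) ^ 2 / α ^ 2 = x ^ 2 := fun x => by field_simp
  have ez : q ^ 2 * (α ^ 2) ^ 2 / (α * β * (α * γ) * (α * δ) * (α * ε) * (α * φ)) =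
      q ^ 2 / (α * β * γ * δ * ε * φ) := by
    field_simp
  simp only [Set.mem_insert_iff, Set.mem_singleton_iff, forall_eq_or_imp, forall_eq, e1, e2, e3,
    e5, e6, e7, e8] at hden hdenη
  obtain ⟨d1, d2, d3, d4, d5, d6, d7, d8, d9⟩ := hden
  obtain ⟨⟨p1, p2, p3, p4⟩, ⟨p5, p6, p7, p8⟩, ⟨p9, p10, p11, p12⟩⟩ := hdenη
  rw [ez] at hz ⊢
  generalize hzdef : q ^ 2 / (α * β * γ * δ * ε * φ) = z at hz ⊢
  have toMul : ∀ {x y : ℂ}, y ≠ 0 → (∀ n : ℕ, x / y * q ^ n ≠ 1) → ∀ n : ℕ, x * q ^ n ≠ y :=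
    fun hy h n h1 => h n (by rw [div_mul_eq_mul_div, h1, div_self hy])
  have r1 := toMul hβ d1
  have r3 := toMul hγ d2
  have r5 := toMul hγ d3
  have r6 := toMul hβ d4
  -- The missing case `β ≠ α` is the condition on `a/b` at `n = 0`.
  have r2 := mul_pow_ne_of_div hα (fun h => r1 0 (by simp [h])) d8
  have r4 := mul_pow_ne_of_div hα (fun h => r3 0 (by simp [h])) d9
  have hadm : VWPAdmissible q α β γ δ ε φ := by
    refine ⟨?_, fun n => ⟨r1 n, r2 n, r3 n, r4 n, r5 n, r6 n⟩, fun n => ⟨d6 n, d7 n, d5 n⟩, ?_⟩ <;>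
      simp only [Set.mem_insert_iff, Set.mem_singleton_iff, forall_eq_or_imp, forall_eq]
    · exact ⟨hα, hβ, hγ, hδ, hε, hφ⟩
    · exact ⟨⟨p2, p6, p10⟩, ⟨p3, p7, p11⟩, ⟨p4, p8, p12⟩⟩
  have hβ1 : β ^ 2 ≠ 1 := by simpa using d6 0
  have hγ1 : γ ^ 2 ≠ 1 := by simpa using d7 0
  have sα : Summable (vwpSymTerm q z α β γ δ ε φ) := summable_vwpSymTerm hq1 hz
    (mul_div_mul_pow_ne_one hβ r1) (mul_div_mul_pow_ne_one hγ r3) p2 p6 p10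
  have sβ : Summable (vwpSymTerm q z β γ α δ ε φ) := summable_vwpSymTerm hq1 hz
    (mul_div_mul_pow_ne_one hγ r5) d8 p3 p7 p11
  have sγ : Summable (vwpSymTerm q z γ α β δ ε φ) := summable_vwpSymTerm hq1 hz
    d9 (mul_div_mul_pow_ne_one hβ r6) p4 p8 p12
  have key := sum_tsum_vwpSymTerm_eq_zero hq0 hq1 hadm hzdef.symm sα sβ sγ
  have c1 := threeTermCoeff_mul (γ := γ) hq1 hα hβ hβ1 d6 (div_mul_pow_ne_one hα r2)
    (div_mul_pow_ne_one hα r4) p2 p6 p10 p1 p5 p9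
  have c2 := threeTermCoeff_mul (γ := β) hq1 hα hγ hγ1 d7 (div_mul_pow_ne_one hα r4)
    (div_mul_pow_ne_one hα r2) p2 p6 p10 p1 p5 p9
  -- Exchanging `b` and `c` reverses the cyclic order of `α, β, γ`; the symmetry of the weight in
  -- its second and third parameters restores it.
  rw [vwpWeightInf_swap q γ β α, vwpWeightInf_swap q α γ β, mul_comm γ β] at c2
  have hB : ∀ x y : ℂ, [α * x, α * x * (α * ε) / α ^ 2, α * x * (α * y) / α ^ 2,
      α * x * (α * δ) / α ^ 2, α * x * (α * φ) / α ^ 2] =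
      [x * α, x * ε, x * y, x * δ, x * φ] := fun x y => by
    rw [e7, e7, e7, e7, mul_comm α x]
  rw [hB, hB, e8, e8]
  have tα := vwpTerm_sq (q := q) hα z β γ δ ε φ
  have tβ := vwpTerm_sq (q := q) hβ z α ε γ δ φ
  have tγ := vwpTerm_sq (q := q) hγ z α ε β δ φ
  rw [vwpSymTerm_rotate] at tβ tγ
  rw [vwpSymTerm_swap] at tγ
  refine ⟨(summable_congr tα).2 (sα.mul_left _), (summable_congr tβ).2 (sβ.mul_left _),
    (summable_congr tγ).2 (sγ.mul_left _), ?_⟩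
  rw [← vwpSymTerm_rotate q z β, vwpSymTerm_swap q z γ, ← vwpSymTerm_rotate q z γ,
    vwpSeries_sq hα ha1, vwpSeries_sq hβ hβ1, vwpSeries_sq hγ hγ1] at key
  -- The total factor of the `α`-series, by which the symmetric relation is divided.
  have hw : (1 - α ^ 2) * vwpWeightInf q α β γ δ ε φ ≠ 0 := by
    have i1 := qPochInf_ne_zero hq1 p1
    have i2 := qPochInf_ne_zero hq1 p2
    have i3 := qPochInf_ne_zero hq1 p5
    have i4 := qPochInf_ne_zero hq1 p6
    have i5 := qPochInf_ne_zero hq1 p9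
    have i6 := qPochInf_ne_zero hq1 p10
    have i7 := qPochInf_ne_zero hq1 (div_mul_pow_ne_one hα r2)
    have i8 := qPochInf_ne_zero hq1 (div_mul_pow_ne_one hα r4)
    have i9 := qPochInf_ne_zero hq1 (self_mul_pow_ne_one hq1)
    exact mul_ne_zero (sub_ne_zero.2 ha1.symm) (by simp [vwpWeightInf, *])
  refine mul_left_cancel₀ hw ?_
  linear_combination key - c1 * vwpSeries q (β ^ 2) [β * α, β * ε, β * γ, β * δ, β * φ] z -
    c2 * vwpSeries q (γ ^ 2) [γ * α, γ * ε, γ * β, γ * δ, γ * φ] z
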